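/- Let $k$ be a field. A ($2$-parameter) persistence module is a functor $M$ from the poset $\mathbb R^2$ (componentwise order) to $k$-vector spaces. For $\delta\ge 0$ write $\vec\delta=(\delta,\delta)$. A $\delta$-interleaving of $M$ and $N$ consists of linear maps $\phi(x):M(x)\to N(x+\vec\delta)$ and $\psi(x):N(x)\to M(x+\vec\delta)$, $x\in\mathbb R^2$, that commute with the structure maps and satisfy $\psi(x+\vec\delta)\phi(x)=M(x\to x+2\vec\delta)$ and $\phi(x+\vec\delta)\psi(x)=N(x\to x+2\vec\delta)$; $d_I(M,N)\in[0,\infty]$ is the infimum of all $\delta\ge0$ for which a $\delta$-interleaving exists. An interval is a nonempty order-convex set $I\subseteq\mathbb R^2$ any two points of which are joined by a finite zigzag $p\le p_1\ge p_2\le\dots\ge p_m\le q$ in $I$. Its interval module is $k$ on $I$ and $0$ elsewhere, with structure maps $x\to y$ equal to $1$ if $x,y\in I$ and $0$ otherwise. A rectangle module is the interval module of a rectangle $[u,v]=\{w\in\mathbb R^2: u\le w\le v\}$, where $u\le v$ in $[-\infty,\infty]^2$; the zero module is also counted as a rectangle module. Let $I$ be a closed and bounded interval in $\mathbb R^2$,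 and let $M$ be its interval module. Let $$L(I)=\{x\in \bar I: y\notin I \text{ whenever } y_1<x_1,\ y_2<x_2\},\qquad U(I)=\{x\in \bar I: y\notin I \text{ whenever } y_1>x_1,\ y_2>x_2\}.$$ Let $[r',s']$ be the smallest rectangle containing $I$. Let $r''$ be the point of $L(I)$ on the diagonal line $\{r'+(t,t):t\in\mathbb R\}$ nearest to $r'$ in $\|\cdot\|_\infty$, and let $s''$ be the point of $U(I)$ on the diagonal line through $s'$ nearest to $s'$. Put $r=\frac12(r'+r'')$, $s=\frac12(s'+s'')$ and $\epsilon_M=\max\{\|r-r'\|_\infty,\|s-s'\|_\infty\}$. Let $\widehat M=0$ if $d_I(M,0)\le\epsilon_M$, and otherwise let $\widehat M$ be the rectangle module of $[r,s]$. Then: 1. $d_I(M,\widehat M)\le\epsilon_M$. 2. If $d_I(M,0)\ge\epsilon_M$, then $d_I(M,\widehat M)=\epsilon_M$. 3. Let $I^\top$ and $I^\bot$ be the inclusion-maximal rectangles contained in $I$ that contain the top-left corner $(r'_1,s'_2)$ and the bottom-right corner $(s'_1,r'_2)$, respectively. If both $I^\top$ and $I^\bot$ contain a (closed, axis-parallel)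 square of side length $2\epsilon_M$, then $\widehat M$ is an optimal rectangle approximation of $M$: it is a rectangle module, and $d_I(M,\widehat M)=\inf\{d_I(M,N): N\text{ a rectangle module}\}$. -/

import Mathlib

open CategoryTheory
open scoped NNReal ENNReal

namespace RectApprox

noncomputable section

universe u

/-! ### Two-parameter persistence modules and the interleaving distance -/

/-- The category structure on `ℝ × ℝ` that is used throughout is that of the poset `ℝ × ℝ` with
its componentwise order (there is exactly one morphism `x ⟶ y` if `x ≤ y`, and none otherwise). -/
instance planeCategory : SmallCategory (ℝ × ℝ) := Preorder.smallCategory (ℝ × ℝ)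

/-- A two-parameter persistence module over the field `k`: a functor from the poset category
`ℝ × ℝ` (componentwise order) to `k`-vector spaces. -/
abbrev PersMod (k : Type u) [Field k] := (ℝ × ℝ) ⥤ ModuleCat.{u} k

/-- The diagonal vector `(δ, δ)`. -/
def diag (δ : ℝ) : ℝ × ℝ := (δ, δ)

theorem le_add_diag (x : ℝ × ℝ) (δ : ℝ≥0) : x ≤ x + diag δ :=
  ⟨by simp [diag], by simp [diag]⟩

theorem le_add_diag_diag (x : ℝ × ℝ) (δ : ℝ≥0) : x ≤ x + diag δ + diag δ :=
  (le_add_diag x δ).trans (le_add_diag _ δ)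

theorem add_diag_le_add_diag {x y : ℝ × ℝ} (h : x ≤ y) (δ : ℝ) : x + diag δ ≤ y + diag δ :=
  add_le_add_left h _

/-- `M` and `N` are `δ`-interleaved: there are families of linear maps
`φ x : M x → N (x + (δ,δ))` and `ψ x : N x → M (x + (δ,δ))`, compatible with the structure maps of
`M` and `N`, whose two composites are the structure maps along `x ≤ x + (2δ,2δ)`. -/
def Interleaved {k : Type u} [Field k] (M N : PersMod k) (δ : ℝ≥0) : Prop :=
  ∃ (φ : ∀ x : ℝ × ℝ, M.obj x ⟶ N.obj (x + diag δ))
    (ψ : ∀ x : ℝ × ℝ, N.obj x ⟶ M.obj (x + diag δ)),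
    (∀ x, φ x ≫ ψ (x + diag δ) = M.map (homOfLE (le_add_diag_diag x δ))) ∧
    (∀ x, ψ x ≫ φ (x + diag δ) = N.map (homOfLE (le_add_diag_diag x δ))) ∧
    (∀ (x y : ℝ × ℝ) (h : x ≤ y),
      M.map (homOfLE h) ≫ φ y = φ x ≫ N.map (homOfLE (add_diag_le_add_diag h δ))) ∧
    (∀ (x y : ℝ × ℝ) (h : x ≤ y),
      N.map (homOfLE h) ≫ ψ y = ψ x ≫ M.map (homOfLE (add_diag_le_add_diag h δ)))

/-- The interleaving distance; it is `∞` when `M` and `N` are not `δ`-interleaved for any `δ`. -/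
def interleavingDist {k : Type u} [Field k] (M N : PersMod k) : ℝ≥0∞ :=
  ⨅ (δ : ℝ≥0) (_ : Interleaved M N δ), (δ : ℝ≥0∞)

/-- The trivial module. -/
def zeroModule (k : Type u) [Field k] : PersMod k :=
  (Functor.const (ℝ × ℝ)).obj (ModuleCat.of k PUnit.{u + 1})

/-- `M` is `δ`-trivializable if `d_I(M, 0) ≤ δ`. -/
def Trivializable {k : Type u} [Field k] (M : PersMod k) (δ : ℝ) : Prop :=
  interleavingDist M (zeroModule k) ≤ ENNReal.ofReal δ

/-! ### Intervals and interval modules -/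

/-- An interval of `ℝ × ℝ`: nonempty, order-convex, and any two of its points are joined by a
finite zigzag of comparable points inside it. -/
structure IsInterval (I : Set (ℝ × ℝ)) : Prop where
  nonempty : I.Nonempty
  ordConnected : I.OrdConnected
  zigzag : ∀ p ∈ I, ∀ q ∈ I,
    Relation.ReflTransGen (fun a b => a ∈ I ∧ b ∈ I ∧ (a ≤ b ∨ b ≤ a)) p q

open Classical in
/-- The vector space of the interval module at `x`: it is `k` if `x ∈ I` and `0` otherwise (both
realised as subspaces of `k`). -/
def fiber (k : Type u) [Field k] (I : Set (ℝ × ℝ)) (x : ℝ × ℝ) : Submodule k k :=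
  if x ∈ I then ⊤ else ⊥

theorem fiber_le (k : Type u) [Field k] {I : Set (ℝ × ℝ)} {x y : ℝ × ℝ} (h : x ∈ I ∧ y ∈ I) :
    fiber k I x ≤ fiber k I y := by
  simp [fiber, h.1, h.2]

open Classical in
/-- The structure map of the interval module: the identity of `k` if `x, y ∈ I`, and `0`
otherwise. -/
def fiberMap (k : Type u) [Field k] (I : Set (ℝ × ℝ)) (x y : ℝ × ℝ) :
    fiber k I x →ₗ[k] fiber k I y :=
  if h : x ∈ I ∧ y ∈ I then Submodule.inclusion (fiber_le k h) else 0

theorem fiber_eq_zero {k : Type u} [Field k] {I : Set (ℝ × ℝ)} {x : ℝ × ℝ} (h : x ∉ I)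
    (c : fiber k I x) : c = 0 := by
  have hc := c.2
  simp only [fiber, h, if_false, Submodule.mem_bot] at hc
  exact Subtype.ext hc

theorem fiberMap_id (k : Type u) [Field k] (I : Set (ℝ × ℝ)) (x : ℝ × ℝ) :
    fiberMap k I x x = LinearMap.id := by
  ext c
  by_cases h : x ∈ I
  · simp [fiberMap, h]
  · simp [fiber_eq_zero h c]

theorem fiberMap_comp (k : Type u) [Field k] {I : Set (ℝ × ℝ)} (hI : I.OrdConnected)
    {x y z : ℝ × ℝ} (hxy : x ≤ y) (hyz : y ≤ z) :
    fiberMap k I y z ∘ₗ fiberMap k I x y = fiberMap k I x z := by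
  ext c
  by_cases hx : x ∈ I
  · by_cases hz : z ∈ I
    · have hy : y ∈ I := hI.out hx hz ⟨hxy, hyz⟩
      simp [fiberMap, hx, hy, hz]
    · simp [fiberMap, hz]
  · simp [fiberMap, hx]

/-- The interval module of an order-convex set `I`. -/
def intervalModule (k : Type u) [Field k] (I : Set (ℝ × ℝ)) (hI : I.OrdConnected) :
    PersMod k where
  obj x := ModuleCat.of k (fiber k I x)
  map {x y} _ := ModuleCat.ofHom (fiberMap k I x y)
  map_id x := by rw [fiberMap_id]; rfl
  map_comp {x y z} f g := by
    rw [← fiberMap_comp k hI (leOfHom f) (leOfHom g)]; rfl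

/-! ### Rectangles and rectangle modules -/

/-- A point of the plane, seen in the extended plane. -/
def toExt (x : ℝ × ℝ) : EReal × EReal := ((x.1 : EReal), (x.2 : EReal))

/-- The rectangle `[a, b]` with corners in the extended plane, as a set of points of the plane
(persistence modules are indexed by `ℝ × ℝ`, so the points at infinity play no role). -/
def rect (a b : EReal × EReal) : Set (ℝ × ℝ) := {w | a ≤ toExt w ∧ toExt w ≤ b}

theorem toExt_mono {x y : ℝ × ℝ} (h : x ≤ y) : toExt x ≤ toExt y :=
  ⟨EReal.coe_le_coe_iff.2 h.1, EReal.coe_le_coe_iff.2 h.2⟩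

theorem rect_ordConnected (a b : EReal × EReal) : (rect a b).OrdConnected :=
  ⟨fun _ hx _ hy _ hz => ⟨hx.1.trans (toExt_mono hz.1), (toExt_mono hz.2).trans hy.2⟩⟩

/-- A rectangle: a set `[a, b]` with `a ≤ b` in the extended plane. -/
def IsRectangle (J : Set (ℝ × ℝ)) : Prop := ∃ a b : EReal × EReal, a ≤ b ∧ J = rect a b

/-- The interval module of the rectangle `[a, b]`. -/
def rectangleModule (k : Type u) [Field k] (a b : EReal × EReal) : PersMod k :=
  intervalModule k (rect a b) (rect_ordConnected a b)

/-- The class of rectangle modules, the trivial module included. -/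
def rectangleModules (k : Type u) [Field k] : Set (PersMod k) :=
  {N | Limits.IsZero N ∨ ∃ a b : EReal × EReal, a ≤ b ∧ Nonempty (N ≅ rectangleModule k a b)}

/-- The distance from a module to a class of modules. -/
def distToClass {k : Type u} [Field k] (d : PersMod k → PersMod k → ℝ≥0∞) (M : PersMod k)
    (C : Set (PersMod k)) : ℝ≥0∞ :=
  ⨅ N ∈ C, d M N

/-- `N`, a member of the class `C`, approximates `M` optimally with respect to `d`. -/
def ApproximatesOptimally {k : Type u} [Field k] (d : PersMod k → PersMod k → ℝ≥0∞)
    (M : PersMod k) (C : Set (PersMod k)) (N : PersMod k) : Prop :=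
  N ∈ C ∧ d M N = distToClass d M C

/-! ### The approximating rectangle -/

/-- The lower boundary of `I`. -/
def lowerBoundary (I : Set (ℝ × ℝ)) : Set (ℝ × ℝ) :=
  {x | x ∈ closure I ∧ ∀ y : ℝ × ℝ, y.1 < x.1 → y.2 < x.2 → y ∉ I}

/-- The upper boundary of `I`. -/
def upperBoundary (I : Set (ℝ × ℝ)) : Set (ℝ × ℝ) :=
  {x | x ∈ closure I ∧ ∀ y : ℝ × ℝ, x.1 < y.1 → x.2 < y.2 → y ∉ I}

/-- The diagonal line through `x`. -/
def diagonalLine (x : ℝ × ℝ) : Set (ℝ × ℝ) := {y | ∃ t : ℝ, y = x + diag t}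

/-- `y` is a point of `S` on the diagonal line through `x` that is closest to `x` in the norm
`‖·‖_∞` (which is the norm that `ℝ × ℝ` carries). -/
def IsDiagProj (S : Set (ℝ × ℝ)) (x y : ℝ × ℝ) : Prop :=
  y ∈ diagonalLine x ∩ S ∧ ∀ z ∈ diagonalLine x ∩ S, ‖x - y‖ ≤ ‖x - z‖

/-- The diagonal projection of `x` to `S`. -/
def diagProj (S : Set (ℝ × ℝ)) (x : ℝ × ℝ) : ℝ × ℝ := Classical.epsilon (IsDiagProj S x)

/-- The lower-left corner `r'` of the bounding rectangle of `I`. -/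
def boxLower (I : Set (ℝ × ℝ)) : ℝ × ℝ := (sInf (Prod.fst '' I), sInf (Prod.snd '' I))

/-- The upper-right corner `s'` of the bounding rectangle of `I`. -/
def boxUpper (I : Set (ℝ × ℝ)) : ℝ × ℝ := (sSup (Prod.fst '' I), sSup (Prod.snd '' I))

/-- The point `r = (r' + r'') / 2`, where `r''` is the diagonal projection of `r'` to the lower
boundary of `I`. -/
def cornerLower (I : Set (ℝ × ℝ)) : ℝ × ℝ :=
  (1 / 2 : ℝ) • (boxLower I + diagProj (lowerBoundary I) (boxLower I))

/-- The point `s = (s' + s'') / 2`, where `s''` is the diagonal projection of `s'` to the upper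
boundary of `I`. -/
def cornerUpper (I : Set (ℝ × ℝ)) : ℝ × ℝ :=
  (1 / 2 : ℝ) • (boxUpper I + diagProj (upperBoundary I) (boxUpper I))

/-- The number `ε_M`, for the interval module `M` of `I`. -/
def eps (I : Set (ℝ × ℝ)) : ℝ :=
  max ‖cornerLower I - boxLower I‖ ‖cornerUpper I - boxUpper I‖

open Classical in
/-- The approximation of the interval module `M` of `I`: the trivial module if `M` is
`ε_M`-trivializable, and the rectangle module of `[r, s]` otherwise. -/
def boxModule (k : Type u) [Field k] (I : Set (ℝ × ℝ)) (hI : I.OrdConnected) : PersMod k :=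
  if Trivializable (intervalModule k I hI) (eps I) then zeroModule k
  else rectangleModule k (toExt (cornerLower I)) (toExt (cornerUpper I))

/-- `J` is a maximal rectangle of `I`: a rectangle contained in `I` and not properly contained in
another rectangle contained in `I`. -/
def IsMaximalRectangle (I J : Set (ℝ × ℝ)) : Prop :=
  Maximal (fun J' => IsRectangle J' ∧ J' ⊆ I) J

/-- `J` is the maximal rectangle of `I` incident to the top-left corner of `I`, which is the
top-left corner of its bounding rectangle. -/
def IsTopLeftMaximalRectangle (I J : Set (ℝ × ℝ)) : Prop :=
  IsMaximalRectangle I J ∧ ((boxLower I).1, (boxUpper I).2) ∈ J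

/-- `J` is the maximal rectangle of `I` incident to the bottom-right corner of `I`. -/
def IsBottomRightMaximalRectangle (I J : Set (ℝ × ℝ)) : Prop :=
  IsMaximalRectangle I J ∧ ((boxUpper I).1, (boxLower I).2) ∈ J

/-- `J` contains an axis-parallel square of side length `a`. -/
def ContainsSquare (J : Set (ℝ × ℝ)) (a : ℝ) : Prop :=
  ∃ c : ℝ × ℝ, Set.Icc c (c + diag a) ⊆ J

/-! ### The objects above are well defined on compact intervals -/

theorem exists_mem_of_zigzag {I : Set (ℝ × ℝ)} (hI : I.OrdConnected) {c : ℝ} {p q : ℝ × ℝ}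
    (h : Relation.ReflTransGen (fun a b => a ∈ I ∧ b ∈ I ∧ (a ≤ b ∨ b ≤ a)) p q)
    (hp : p ∈ I) (hpc : c ≤ p.2 - p.1) (hqc : q.2 - q.1 ≤ c) : ∃ z ∈ I, z.2 - z.1 = c := by
  by_contra! hne
  suffices H : c ≤ q.2 - q.1 ∧ q ∈ I from hne q H.2 (le_antisymm hqc H.1)
  clear hqc
  induction h with
  | refl => exact ⟨hpc, hp⟩
  | @tail a b _ hab ih =>
    obtain ⟨ha, hb, hc⟩ := hab
    refine ⟨?_, hb⟩
    by_contra! hlt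
    obtain ⟨ih, -⟩ := ih
    have hd : 0 < (a.2 - a.1) - (b.2 - b.1) := by linarith
    obtain ⟨t, ht⟩ : ∃ t, t = ((a.2 - a.1) - c) / ((a.2 - a.1) - (b.2 - b.1)) := ⟨_, rfl⟩
    have ht0 : 0 ≤ t := by rw [ht]; exact div_nonneg (by linarith) hd.le
    have ht1 : t ≤ 1 := by rw [ht, div_le_one hd]; linarith
    have hte : t * ((a.2 - a.1) - (b.2 - b.1)) = (a.2 - a.1) - c := by
      rw [ht]; field_simp
    refine hne (a.1 + t * (b.1 - a.1), a.2 + t * (b.2 - a.2)) ?_ (by simp only; linarith)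
    rcases hc with hc | hc
    · exact hI.out ha hb ⟨⟨by simp only; nlinarith [hc.1], by simp only; nlinarith [hc.2]⟩,
        ⟨by simp only; nlinarith [hc.1], by simp only; nlinarith [hc.2]⟩⟩
    · exact hI.out hb ha ⟨⟨by simp only; nlinarith [hc.1], by simp only; nlinarith [hc.2]⟩,
        ⟨by simp only; nlinarith [hc.1], by simp only; nlinarith [hc.2]⟩⟩

/-- `[r', s']` contains `I`. -/
theorem box_bounds {I : Set (ℝ × ℝ)} (hc : IsCompact I) {x : ℝ × ℝ} (hx : x ∈ I) :
    boxLower I ≤ x ∧ x ≤ boxUpper I := by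
  have h1 := hc.image continuous_fst
  have h2 := hc.image continuous_snd
  exact ⟨⟨csInf_le h1.bddBelow ⟨x, hx, rfl⟩, csInf_le h2.bddBelow ⟨x, hx, rfl⟩⟩,
    ⟨le_csSup h1.bddAbove ⟨x, hx, rfl⟩, le_csSup h2.bddAbove ⟨x, hx, rfl⟩⟩⟩

/-- Each side of `[r', s']` contains a point of `I`. -/
theorem box_attained {I : Set (ℝ × ℝ)} (hc : IsCompact I) (hne : I.Nonempty) :
    (∃ x ∈ I, x.1 = (boxLower I).1) ∧ (∃ x ∈ I, x.2 = (boxLower I).2) ∧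
    (∃ x ∈ I, x.1 = (boxUpper I).1) ∧ (∃ x ∈ I, x.2 = (boxUpper I).2) := by
  have h1 := hc.image continuous_fst
  have h2 := hc.image continuous_snd
  exact ⟨h1.sInf_mem (hne.image _), h2.sInf_mem (hne.image _), h1.sSup_mem (hne.image _),
    h2.sSup_mem (hne.image _)⟩

/-- `[r', s']` is the bounding rectangle of `I`, that is, the smallest rectangle containing `I`. -/
theorem box_isLeast {I : Set (ℝ × ℝ)} (hc : IsCompact I) (hne : I.Nonempty) :
    IsLeast {J | IsRectangle J ∧ I ⊆ J} (rect (toExt (boxLower I)) (toExt (boxUpper I))) := by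
  obtain ⟨x₀, hx₀⟩ := hne
  have hb := box_bounds hc hx₀
  refine ⟨⟨⟨_, _, toExt_mono (hb.1.trans hb.2), rfl⟩, fun x hx =>
    ⟨toExt_mono (box_bounds hc hx).1, toExt_mono (box_bounds hc hx).2⟩⟩, ?_⟩
  rintro _ ⟨⟨a, b, -, rfl⟩, hIJ⟩ w hw
  obtain ⟨⟨x, hx, hx'⟩, ⟨y, hy, hy'⟩, ⟨z, hz, hz'⟩, ⟨t, ht, ht'⟩⟩ := box_attained hc ⟨x₀, hx₀⟩
  have h1 := (hIJ hx).1.1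
  have h2 := (hIJ hy).1.2
  have h3 := (hIJ hz).2.1
  have h4 := (hIJ ht).2.2
  simp only [toExt, hx', hy', hz', ht'] at h1 h2 h3 h4
  exact ⟨⟨h1.trans hw.1.1, h2.trans hw.1.2⟩, ⟨hw.2.1.trans h3, hw.2.2.trans h4⟩⟩

/-- The top-left and bottom-right corners of the bounding rectangle belong to `I`. -/
theorem corners_mem {I : Set (ℝ × ℝ)} (hI : IsInterval I) (hc : IsCompact I) :
    ((boxLower I).1, (boxUpper I).2) ∈ I ∧ ((boxUpper I).1, (boxLower I).2) ∈ I := by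
  obtain ⟨⟨x, hx, hx'⟩, ⟨y, hy, hy'⟩, ⟨z, hz, hz'⟩, ⟨t, ht, ht'⟩⟩ := box_attained hc hI.nonempty
  exact ⟨hI.ordConnected.out hx ht
      ⟨⟨hx'.le, (box_bounds hc hx).2.2⟩, ⟨(box_bounds hc ht).1.1, ht'.ge⟩⟩,
    hI.ordConnected.out hy hz
      ⟨⟨(box_bounds hc hy).2.1, hy'.le⟩, ⟨hz'.ge, (box_bounds hc hz).1.2⟩⟩⟩

theorem isCompact_diagonal_inter {I : Set (ℝ × ℝ)} (hc : IsCompact I) (x : ℝ × ℝ) :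
    IsCompact {t : ℝ | x + diag t ∈ I} := by
  have hcl : IsClosed {t : ℝ | x + diag t ∈ I} :=
    hc.isClosed.preimage (by unfold diag; fun_prop)
  refine Metric.isCompact_of_isClosed_isBounded hcl ?_
  have h1 := hc.image continuous_fst
  refine (Metric.isBounded_Icc (sInf (Prod.fst '' I) - x.1) (sSup (Prod.fst '' I) - x.1)).subset ?_
  intro t ht
  have a := csInf_le h1.bddBelow ⟨_, ht, rfl⟩
  have b := le_csSup h1.bddAbove ⟨_, ht, rfl⟩
  simp only [diag, Prod.fst_add] at a b
  exact ⟨by linarith, by linarith⟩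

theorem norm_sub_add_diag (x : ℝ × ℝ) (t : ℝ) : ‖x - (x + diag t)‖ = |t| := by
  simp [diag, Prod.norm_def]

/-- The diagonal projection `r''` of `r'` to the lower boundary of `I` exists and is unique. -/
theorem existsUnique_proj_lower {I : Set (ℝ × ℝ)} (hI : IsInterval I) (hc : IsCompact I) :
    ∃! y, IsDiagProj (lowerBoundary I) (boxLower I) y := by
  obtain ⟨hp, hq⟩ := corners_mem hI hc
  have hb := box_bounds hc hp
  have hb' := box_bounds hc hq
  obtain ⟨z, hz, hzc⟩ := exists_mem_of_zigzag hI.ordConnected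
    (c := (boxLower I).2 - (boxLower I).1) (hI.zigzag _ hp _ hq) hp
    (by have := hb.1.2; simp only at this ⊢; linarith)
    (by have := hb'.1.1; simp only at this ⊢; linarith)
  have hzS : (z.1 - (boxLower I).1) ∈ {t : ℝ | boxLower I + diag t ∈ I} := by
    have : boxLower I + diag (z.1 - (boxLower I).1) = z := by
      ext <;> simp [diag]; linarith
    simpa [this] using hz
  obtain ⟨t, ht, htmin⟩ := (isCompact_diagonal_inter hc (boxLower I)).exists_isLeast ⟨_, hzS⟩
  have hpos : ∀ s, boxLower I + diag s ∈ I → 0 ≤ s := fun s hs => by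
    have := (box_bounds hc hs).1.1
    simpa [diag] using this
  have hL : boxLower I + diag t ∈ lowerBoundary I := by
    refine ⟨subset_closure ht, fun y h1 h2 hy => ?_⟩
    simp only [diag, Prod.fst_add, Prod.snd_add] at h1 h2
    have hm : max (y.1 - (boxLower I).1) (y.2 - (boxLower I).2) ∈
        {t : ℝ | boxLower I + diag t ∈ I} := by
      refine hI.ordConnected.out hy ht ⟨⟨?_, ?_⟩, ⟨?_, ?_⟩⟩
      · simp only [diag, Prod.fst_add]
        linarith [le_max_left (y.1 - (boxLower I).1) (y.2 - (boxLower I).2)]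
      · simp only [diag, Prod.snd_add]
        linarith [le_max_right (y.1 - (boxLower I).1) (y.2 - (boxLower I).2)]
      · simp only [diag, Prod.fst_add, add_le_add_iff_left, max_le_iff]
        constructor <;> linarith
      · simp only [diag, Prod.snd_add, add_le_add_iff_left, max_le_iff]
        constructor <;> linarith
    have := htmin hm
    rcases le_max_iff.1 this with h | h <;> linarith
  refine ⟨boxLower I + diag t, ⟨⟨⟨t, rfl⟩, hL⟩, ?_⟩, ?_⟩
  · rintro _ ⟨⟨s, rfl⟩, hs⟩
    have hsI : boxLower I + diag s ∈ I := hc.isClosed.closure_subset hs.1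
    rw [norm_sub_add_diag, norm_sub_add_diag, abs_of_nonneg (hpos _ ht), abs_of_nonneg (hpos _ hsI)]
    exact htmin hsI
  · rintro _ ⟨⟨⟨s, rfl⟩, hs⟩, -⟩
    have hsI : boxLower I + diag s ∈ I := hc.isClosed.closure_subset hs.1
    rcases (htmin hsI).eq_or_lt with h | h
    · rw [h]
    · exact absurd ht (hs.2 _ (by simpa [diag] using h) (by simpa [diag] using h))

/-- The diagonal projection `s''` of `s'` to the upper boundary of `I` exists and is unique. -/
theorem existsUnique_proj_upper {I : Set (ℝ × ℝ)} (hI : IsInterval I) (hc : IsCompact I) :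
    ∃! y, IsDiagProj (upperBoundary I) (boxUpper I) y := by
  obtain ⟨hp, hq⟩ := corners_mem hI hc
  have hb := box_bounds hc hp
  have hb' := box_bounds hc hq
  obtain ⟨z, hz, hzc⟩ := exists_mem_of_zigzag hI.ordConnected
    (c := (boxUpper I).2 - (boxUpper I).1) (hI.zigzag _ hp _ hq) hp
    (by have := hb.2.1; simp only at this ⊢; linarith)
    (by have := hb'.2.2; simp only at this ⊢; linarith)
  have hzS : (z.1 - (boxUpper I).1) ∈ {t : ℝ | boxUpper I + diag t ∈ I} := by
    have : boxUpper I + diag (z.1 - (boxUpper I).1) = z := by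
      ext <;> simp [diag]; linarith
    simpa [this] using hz
  obtain ⟨t, ht, htmax⟩ := (isCompact_diagonal_inter hc (boxUpper I)).exists_isGreatest ⟨_, hzS⟩
  have hneg : ∀ s, boxUpper I + diag s ∈ I → s ≤ 0 := fun s hs => by
    have := (box_bounds hc hs).2.1
    simpa [diag] using this
  have hU : boxUpper I + diag t ∈ upperBoundary I := by
    refine ⟨subset_closure ht, fun y h1 h2 hy => ?_⟩
    simp only [diag, Prod.fst_add, Prod.snd_add] at h1 h2
    have hm : min (y.1 - (boxUpper I).1) (y.2 - (boxUpper I).2) ∈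
        {t : ℝ | boxUpper I + diag t ∈ I} := by
      refine hI.ordConnected.out ht hy ⟨⟨?_, ?_⟩, ⟨?_, ?_⟩⟩
      · simp only [diag, Prod.fst_add, add_le_add_iff_left, le_min_iff]
        constructor <;> linarith
      · simp only [diag, Prod.snd_add, add_le_add_iff_left, le_min_iff]
        constructor <;> linarith
      · simp only [diag, Prod.fst_add]
        linarith [min_le_left (y.1 - (boxUpper I).1) (y.2 - (boxUpper I).2)]
      · simp only [diag, Prod.snd_add]
        linarith [min_le_right (y.1 - (boxUpper I).1) (y.2 - (boxUpper I).2)]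
    have := htmax hm
    rcases min_le_iff.1 this with h | h <;> linarith
  refine ⟨boxUpper I + diag t, ⟨⟨⟨t, rfl⟩, hU⟩, ?_⟩, ?_⟩
  · rintro _ ⟨⟨s, rfl⟩, hs⟩
    have hsI : boxUpper I + diag s ∈ I := hc.isClosed.closure_subset hs.1
    rw [norm_sub_add_diag, norm_sub_add_diag, abs_of_nonpos (hneg _ ht), abs_of_nonpos (hneg _ hsI)]
    exact neg_le_neg (htmax hsI)
  · rintro _ ⟨⟨⟨s, rfl⟩, hs⟩, -⟩
    have hsI : boxUpper I + diag s ∈ I := hc.isClosed.closure_subset hs.1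
    rcases (htmax hsI).eq_or_lt with h | h
    · rw [h]
    · exact absurd ht (hs.2 _ (by simpa [diag] using h) (by simpa [diag] using h))

/-- A compact interval has exactly one maximal rectangle incident to its top-left corner. -/
theorem existsUnique_topLeft {I : Set (ℝ × ℝ)} (hI : IsInterval I) (hc : IsCompact I) :
    ∃! J, IsTopLeftMaximalRectangle I J := by
  obtain ⟨hp, -⟩ := corners_mem hI hc
  obtain ⟨p, hpdef⟩ : ∃ p : ℝ × ℝ, p = ((boxLower I).1, (boxUpper I).2) := ⟨_, rfl⟩
  rw [← hpdef] at hp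
  have hx : ∀ x ∈ I, p.1 ≤ x.1 ∧ x.2 ≤ p.2 := fun x hx =>
    hpdef ▸ ⟨(box_bounds hc hx).1.1, (box_bounds hc hx).2.2⟩
  have h1 : IsCompact (I ∩ {x | x.1 = p.1}) :=
    hc.inter_right (isClosed_eq continuous_fst continuous_const)
  have h2 : IsCompact (I ∩ {x | x.2 = p.2}) :=
    hc.inter_right (isClosed_eq continuous_snd continuous_const)
  obtain ⟨a, ⟨haI, ha⟩, hamin⟩ := h1.exists_isMinOn ⟨p, hp, rfl⟩ continuous_snd.continuousOn
  obtain ⟨b, ⟨hbI, hb⟩, hbmax⟩ := h2.exists_isMaxOn ⟨p, hp, rfl⟩ continuous_fst.continuousOn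
  simp only [Set.mem_ofPred_eq] at ha hb
  have key : ∀ J, IsRectangle J → J ⊆ I → p ∈ J → J ⊆ rect (toExt a) (toExt b) := by
    rintro _ ⟨u, v, -, rfl⟩ hJ hpJ w hw
    have hwI := hx _ (hJ hw)
    have e1 : (p.1, w.2) ∈ rect u v :=
      ⟨⟨hpJ.1.1, hw.1.2⟩, ⟨hpJ.2.1, hw.2.2⟩⟩
    have e2 : (w.1, p.2) ∈ rect u v :=
      ⟨⟨hw.1.1, hpJ.1.2⟩, ⟨hw.2.1, hpJ.2.2⟩⟩
    have f1 : a.2 ≤ w.2 := isMinOn_iff.1 hamin (p.1, w.2) ⟨hJ e1, rfl⟩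
    have f2 : w.1 ≤ b.1 := isMaxOn_iff.1 hbmax (w.1, p.2) ⟨hJ e2, rfl⟩
    exact ⟨toExt_mono ⟨ha.trans_le hwI.1, f1⟩, toExt_mono ⟨f2, hwI.2.trans hb.ge⟩⟩
  have hab : a ≤ b := ⟨ha.trans_le (hx b hbI).1, (hx a haI).2.trans hb.ge⟩
  have hT : IsRectangle (rect (toExt a) (toExt b)) := ⟨_, _, toExt_mono hab, rfl⟩
  have hTI : rect (toExt a) (toExt b) ⊆ I := fun w hw =>
    hI.ordConnected.out haI hbI
      ⟨⟨EReal.coe_le_coe_iff.1 hw.1.1, EReal.coe_le_coe_iff.1 hw.1.2⟩,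
        ⟨EReal.coe_le_coe_iff.1 hw.2.1, EReal.coe_le_coe_iff.1 hw.2.2⟩⟩
  have hpT : p ∈ rect (toExt a) (toExt b) :=
    ⟨toExt_mono ⟨ha.le, (hx a haI).2⟩, toExt_mono ⟨(hx b hbI).1, hb.ge⟩⟩
  refine ⟨rect (toExt a) (toExt b), ⟨⟨⟨hT, hTI⟩, fun J hJ hle => ?_⟩, ?_⟩, ?_⟩
  · exact key J hJ.1 hJ.2 (hle hpT)
  · rw [← hpdef]; exact hpT
  · rintro J ⟨hJ, hpJ⟩
    have hs := key J hJ.prop.1 hJ.prop.2 (hpdef ▸ hpJ)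
    exact subset_antisymm hs (hJ.le_of_ge ⟨hT, hTI⟩ hs)

/-- A compact interval has exactly one maximal rectangle incident to its bottom-right corner. -/
theorem existsUnique_bottomRight {I : Set (ℝ × ℝ)} (hI : IsInterval I) (hc : IsCompact I) :
    ∃! J, IsBottomRightMaximalRectangle I J := by
  obtain ⟨-, hp⟩ := corners_mem hI hc
  obtain ⟨p, hpdef⟩ : ∃ p : ℝ × ℝ, p = ((boxUpper I).1, (boxLower I).2) := ⟨_, rfl⟩
  rw [← hpdef] at hp
  have hx : ∀ x ∈ I, x.1 ≤ p.1 ∧ p.2 ≤ x.2 := fun x hx =>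
    hpdef ▸ ⟨(box_bounds hc hx).2.1, (box_bounds hc hx).1.2⟩
  have h1 : IsCompact (I ∩ {x | x.1 = p.1}) :=
    hc.inter_right (isClosed_eq continuous_fst continuous_const)
  have h2 : IsCompact (I ∩ {x | x.2 = p.2}) :=
    hc.inter_right (isClosed_eq continuous_snd continuous_const)
  obtain ⟨b, ⟨hbI, hb⟩, hbmax⟩ := h1.exists_isMaxOn ⟨p, hp, rfl⟩ continuous_snd.continuousOn
  obtain ⟨a, ⟨haI, ha⟩, hamin⟩ := h2.exists_isMinOn ⟨p, hp, rfl⟩ continuous_fst.continuousOn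
  simp only [Set.mem_ofPred_eq] at ha hb
  have key : ∀ J, IsRectangle J → J ⊆ I → p ∈ J → J ⊆ rect (toExt a) (toExt b) := by
    rintro _ ⟨u, v, -, rfl⟩ hJ hpJ w hw
    have hwI := hx _ (hJ hw)
    have e1 : (p.1, w.2) ∈ rect u v :=
      ⟨⟨hpJ.1.1, hw.1.2⟩, ⟨hpJ.2.1, hw.2.2⟩⟩
    have e2 : (w.1, p.2) ∈ rect u v :=
      ⟨⟨hw.1.1, hpJ.1.2⟩, ⟨hw.2.1, hpJ.2.2⟩⟩
    have f1 : w.2 ≤ b.2 := isMaxOn_iff.1 hbmax (p.1, w.2) ⟨hJ e1, rfl⟩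
    have f2 : a.1 ≤ w.1 := isMinOn_iff.1 hamin (w.1, p.2) ⟨hJ e2, rfl⟩
    exact ⟨toExt_mono ⟨f2, ha.trans_le hwI.2⟩, toExt_mono ⟨hwI.1.trans hb.ge, f1⟩⟩
  have hab : a ≤ b := ⟨(hx a haI).1.trans hb.ge, ha.trans_le (hx b hbI).2⟩
  have hT : IsRectangle (rect (toExt a) (toExt b)) := ⟨_, _, toExt_mono hab, rfl⟩
  have hTI : rect (toExt a) (toExt b) ⊆ I := fun w hw =>
    hI.ordConnected.out haI hbI
      ⟨⟨EReal.coe_le_coe_iff.1 hw.1.1, EReal.coe_le_coe_iff.1 hw.1.2⟩,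
        ⟨EReal.coe_le_coe_iff.1 hw.2.1, EReal.coe_le_coe_iff.1 hw.2.2⟩⟩
  have hpT : p ∈ rect (toExt a) (toExt b) :=
    ⟨toExt_mono ⟨(hx a haI).1, ha.le⟩, toExt_mono ⟨hb.ge, (hx b hbI).2⟩⟩
  refine ⟨rect (toExt a) (toExt b), ⟨⟨⟨hT, hTI⟩, fun J hJ hle => ?_⟩, ?_⟩, ?_⟩
  · exact key J hJ.1 hJ.2 (hle hpT)
  · rw [← hpdef]; exact hpT
  · rintro J ⟨hJ, hpJ⟩
    have hs := key J hJ.prop.1 hJ.prop.2 (hpdef ▸ hpJ)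
    exact subset_antisymm hs (hJ.le_of_ge ⟨hT, hTI⟩ hs)

end

end RectApprox

open CategoryTheory
open scoped NNReal ENNReal

namespace RectApprox

noncomputable section

universe u

variable {k : Type u} [Field k]

/-! ### Maps between interval modules -/

/-! Identify a real number with its diagonal vector. Then r'' = r' + 2a, r = r' + a, s'' = s' - 2b,
s = s' - b and ε = max(a, b). The corner r'' is the lowest point of I on its diagonal, and s'' the
highest on its own.

Upper bound: the maps that are the identity of `k` wherever both fibers are nonzero form an
ε-interleaving of M with the module of [r, s]. By r' ≤ I ≤ s', shifting a point of I by ε moves it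
above r, and shifting it back moves it below s. By convexity, a point between r'' and a point of I,
or between a point of I and s'', lies in I (`interleaved_cornerRectangle`).

Lower bounds rest on a rigidity statement, `Interleaved.mem_of_mem`: if x and x + 2δ lie in I, a
δ-interleaving with the module of J puts x + δ in J, and then points of J below or above x + δ can
be shifted by δ into I. If δ < ε and J = [r, s], this puts r + δ and s - δ in I, so a ≤ δ and b ≤ δ
by extremality of r'' and s'', a contradiction. For an arbitrary rectangle J, the two squares
provide such points x near the top-left and bottom-right corners. Mixing coordinates of the two
midpoints gives r' + δ and s' - δ in J, hence r' + 2δ and s' - 2δ in I, and again ε ≤ δ. -/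

open Classical in
/-- The canonical map from the interval module of `I` at `x` to that of `J` at `y`: the identity
of `k` if `x ∈ I` and `y ∈ J`, and `0` otherwise. -/
def fiberBridge (k : Type u) [Field k] (I J : Set (ℝ × ℝ)) (x y : ℝ × ℝ) :
    fiber k I x →ₗ[k] fiber k J y :=
  if h : x ∈ I ∧ y ∈ J then Submodule.inclusion (by simp [fiber, h.1, h.2]) else 0

open Classical in
theorem coe_fiberBridge (I J : Set (ℝ × ℝ)) (x y : ℝ × ℝ) (c : fiber k I x) :
    (fiberBridge k I J x y c : k) = if y ∈ J then (c : k) else 0 := by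
  by_cases hx : x ∈ I
  · by_cases hy : y ∈ J <;> simp [fiberBridge, hx, hy]
  · simp [fiber_eq_zero hx c]

theorem fiberMap_eq_fiberBridge (I : Set (ℝ × ℝ)) (x y : ℝ × ℝ) :
    fiberMap k I x y = fiberBridge k I I x y := rfl

theorem mem_of_ne_zero {I : Set (ℝ × ℝ)} {x : ℝ × ℝ} {c : fiber k I x} (hc : c ≠ 0) : x ∈ I := by
  by_contra h
  exact hc (fiber_eq_zero h c)

/-- Nothing is needed at `x`: outside `I` the source is zero. Dually, surjectivity below needs
nothing at `y`. -/
theorem fiberMap_injective {I : Set (ℝ × ℝ)} {x y : ℝ × ℝ} (hy : y ∈ I) :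
    Function.Injective (fiberMap k I x y) := by
  intro c d h
  have := congrArg Subtype.val h
  rw [fiberMap_eq_fiberBridge, coe_fiberBridge, coe_fiberBridge, if_pos hy, if_pos hy] at this
  exact Subtype.ext this

theorem fiberMap_surjective {I : Set (ℝ × ℝ)} {x y : ℝ × ℝ} (hx : x ∈ I) :
    Function.Surjective (fiberMap k I x y) := by
  intro c
  by_cases hy : y ∈ I
  · refine ⟨⟨c, by simp [fiber, hx]⟩, Subtype.ext ?_⟩
    rw [fiberMap_eq_fiberBridge, coe_fiberBridge, if_pos hy]
  · exact ⟨0, by rw [map_zero, fiber_eq_zero hy c]⟩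

theorem exists_fiber_ne_zero {I : Set (ℝ × ℝ)} {x : ℝ × ℝ} (hx : x ∈ I) :
    ∃ c : fiber k I x, c ≠ 0 :=
  ⟨⟨1, by simp [fiber, hx]⟩, fun h => one_ne_zero (congrArg Subtype.val h)⟩

/-! ### Interleavings -/

/-- The first two hypotheses keep the middle fiber alive whenever a 2δ structure map is nonzero,
which gives the triangle identities. The last two make both paths around each naturality square
nonzero as soon as its end fibers are. -/
theorem interleaved_intervalModule {I J : Set (ℝ × ℝ)} (hI : I.OrdConnected)
    (hJ : J.OrdConnected) {δ : ℝ≥0}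
    (hIJI : ∀ x ∈ I, x + diag δ + diag δ ∈ I → x + diag δ ∈ J)
    (hJIJ : ∀ x ∈ J, x + diag δ + diag δ ∈ J → x + diag δ ∈ I)
    (hIJ : ∀ x ∈ I, ∀ y, x ≤ y → y + diag δ ∈ J → x + diag δ ∈ J ∧ y ∈ I)
    (hJI : ∀ x ∈ J, ∀ y, x ≤ y → y + diag δ ∈ I → x + diag δ ∈ I ∧ y ∈ J) :
    Interleaved (intervalModule k I hI) (intervalModule k J hJ) δ := by
  have comp : ∀ {I J : Set (ℝ × ℝ)}, (∀ x ∈ I, x + diag δ + diag δ ∈ I → x + diag δ ∈ J) →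
      ∀ x, fiberBridge k J I (x + diag δ) (x + diag δ + diag δ) ∘ₗ
        fiberBridge k I J x (x + diag δ) = fiberMap k I x (x + diag δ + diag δ) := by
    intro I J h x
    ext c
    simp only [LinearMap.comp_apply, fiberMap_eq_fiberBridge, coe_fiberBridge]
    by_cases hx : x ∈ I
    · have := h x hx
      split_ifs <;> tauto
    · simp [fiber_eq_zero hx c]
  have nat : ∀ {I J : Set (ℝ × ℝ)},
      (∀ x ∈ I, ∀ y, x ≤ y → y + diag δ ∈ J → x + diag δ ∈ J ∧ y ∈ I) →
      ∀ x y, x ≤ y → fiberBridge k I J y (y + diag δ) ∘ₗ fiberMap k I x y =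
        fiberMap k J (x + diag δ) (y + diag δ) ∘ₗ fiberBridge k I J x (x + diag δ) := by
    intro I J h x y hxy
    ext c
    simp only [LinearMap.comp_apply, fiberMap_eq_fiberBridge, coe_fiberBridge]
    by_cases hx : x ∈ I
    · have := h x hx y hxy
      split_ifs <;> tauto
    · simp [fiber_eq_zero hx c]
  exact ⟨fun x => ModuleCat.ofHom (fiberBridge k I J x (x + diag δ)),
    fun x => ModuleCat.ofHom (fiberBridge k J I x (x + diag δ)),
    fun x => congrArg ModuleCat.ofHom (comp hIJI x),
    fun x => congrArg ModuleCat.ofHom (comp hJIJ x),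
    fun x y h => congrArg ModuleCat.ofHom (nat hIJ x y h),
    fun x y h => congrArg ModuleCat.ofHom (nat hJI x y h)⟩

theorem Interleaved.of_iso {M N N' : PersMod k} {δ : ℝ≥0} (h : Interleaved M N δ)
    (e : N ≅ N') : Interleaved M N' δ := by
  obtain ⟨φ, ψ, h1, h2, h3, h4⟩ := h
  refine ⟨fun x => φ x ≫ e.hom.app _, fun x => e.inv.app x ≫ ψ x, fun x => ?_, fun x => ?_,
    fun x y h => ?_, fun x y h => ?_⟩
  · simp [h1]
  · rw [Category.assoc, reassoc_of% (h2 x)]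
    simp
  · rw [reassoc_of% (h3 x y h)]
    simp
  · rw [Category.assoc, ← h4 x y h]
    simp

/-- The hypothesis makes every structure map along a shift by 2δ vanish, so the zero maps suffice.
-/
theorem interleaved_zeroModule {I : Set (ℝ × ℝ)} (hI : I.OrdConnected) {δ : ℝ≥0}
    (h : ∀ x ∈ I, x + diag δ + diag δ ∉ I) :
    Interleaved (intervalModule k I hI) (zeroModule k) δ := by
  refine ⟨fun _ => 0, fun _ => 0, fun x => ?_, fun x => ?_, fun x y h => by simp,
    fun x y h => by simp⟩
  · rw [Limits.zero_comp]
    refine (congrArg ModuleCat.ofHom (?_ : fiberMap k I x _ = 0)).symm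
    ext c
    by_cases hx : x ∈ I
    · simp [fiberMap, h x hx]
    · simp [fiber_eq_zero hx c]
  · ext c
    exact Subsingleton.elim (α := PUnit) _ _

theorem not_interleaved_of_isZero {I : Set (ℝ × ℝ)} {hI : I.OrdConnected} {N : PersMod k}
    (hN : Limits.IsZero N) {δ : ℝ≥0} {x : ℝ × ℝ} (hx : x ∈ I) (hx' : x + diag δ + diag δ ∈ I) :
    ¬ Interleaved (intervalModule k I hI) N δ := by
  rintro ⟨φ, ψ, h1, -⟩
  obtain ⟨c, hc⟩ := exists_fiber_ne_zero (k := k) hx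
  have hz : φ x = 0 := (hN.obj (x + diag δ)).eq_of_tgt _ _
  have := h1 x
  rw [hz, Limits.zero_comp] at this
  have h0 : fiberMap k I x (x + diag δ + diag δ) = 0 := (congrArg ModuleCat.Hom.hom this).symm
  refine hc (fiberMap_injective hx' ?_)
  rw [h0, map_zero, LinearMap.zero_apply]

theorem isZero_zeroModule : Limits.IsZero (zeroModule k) :=
  Functor.isZero _ fun _ => ModuleCat.isZero_of_subsingleton (ModuleCat.of k PUnit)

/-- If `x` and `x + 2δ` lie in `I`, then a `δ`-interleaving with the interval module of `J`
forces `x + δ` into `J`, and shifts of the points of `J` comparable with `x + δ` into `I`. -/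
theorem Interleaved.mem_of_mem {I J : Set (ℝ × ℝ)} {hI : I.OrdConnected} {hJ : J.OrdConnected}
    {δ : ℝ≥0} (h : Interleaved (intervalModule k I hI) (intervalModule k J hJ) δ) {x : ℝ × ℝ}
    (hx : x ∈ I) (hx' : x + diag δ + diag δ ∈ I) :
    x + diag δ ∈ J ∧ (∀ p ∈ J, p ≤ x + diag δ → p + diag δ ∈ I) ∧
      ∀ q, q + diag δ ∈ J → x ≤ q → q ∈ I := by
  obtain ⟨φ', ψ', h1', -, h3', h4'⟩ := h
  let φ : ∀ x, fiber k I x →ₗ[k] fiber k J (x + diag δ) := fun x => (φ' x).hom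
  let ψ : ∀ x, fiber k J x →ₗ[k] fiber k I (x + diag δ) := fun x => (ψ' x).hom
  have h1 : ∀ x c, ψ _ (φ x c) = fiberMap k I x (x + diag δ + diag δ) c :=
    fun x c => congrArg (fun f => f.hom c) (h1' x)
  have h3 : ∀ x y, x ≤ y → ∀ c, φ y (fiberMap k I x y c) = fiberMap k J _ _ (φ x c) :=
    fun x y h c => congrArg (fun f => f.hom c) (h3' x y h)
  have h4 : ∀ x y, x ≤ y → ∀ c, ψ y (fiberMap k J x y c) = fiberMap k I _ _ (ψ x c) :=
    fun x y h c => congrArg (fun f => f.hom c) (h4' x y h)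
  obtain ⟨c, hc⟩ := exists_fiber_ne_zero (k := k) hx
  have hψφ : ψ _ (φ x c) ≠ 0 := by
    rw [h1]
    exact (map_ne_zero_iff _ (fiberMap_injective hx')).2 hc
  have hφ : φ x c ≠ 0 := fun h0 => hψφ (by rw [h0, map_zero])
  refine ⟨mem_of_ne_zero hφ, fun p hp hpx => ?_, fun q hq hxq => ?_⟩
  -- Since φ c is the image of some `d` at `p`, naturality makes the nonzero ψ φ c factor through ψ
  -- d, which lives over p + δ.
  · obtain ⟨d, hd⟩ := fiberMap_surjective hp (φ x c)
    rw [← hd, h4 _ _ hpx] at hψφ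
    exact mem_of_ne_zero (c := ψ p d) fun h0 => hψφ (by rw [h0, map_zero])
  -- Transporting φ c to q + δ keeps it nonzero; by naturality it is φ of the transport of c to `q`,
  -- so the fiber there is nonzero.
  · have h0 : fiberMap k J (x + diag δ) (q + diag δ) (φ x c) ≠ 0 :=
      (map_ne_zero_iff _ (fiberMap_injective hq)).2 hφ
    rw [← h3 _ _ hxq] at h0
    exact mem_of_ne_zero (c := fiberMap k I x q c) fun h => h0 (by simp [h])

theorem le_interleavingDist {M N : PersMod k} {e : ℝ}
    (h : ∀ δ : ℝ≥0, (δ : ℝ) < e → ¬ Interleaved M N δ) :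
    ENNReal.ofReal e ≤ interleavingDist M N := by
  refine le_iInf₂ fun δ hδ => ?_
  rw [← ENNReal.ofReal_coe_nnreal]
  exact ENNReal.ofReal_le_ofReal (not_lt.1 fun hlt => h δ hlt hδ)

theorem interleavingDist_le {M N : PersMod k} {δ : ℝ≥0} {e : ℝ} (h : Interleaved M N δ)
    (hδ : (δ : ℝ) = e) : interleavingDist M N ≤ ENNReal.ofReal e := by
  rw [← hδ, ENNReal.ofReal_coe_nnreal]
  exact iInf₂_le _ h

/-! ### The corners of the approximating rectangle -/

theorem mem_rect_toExt {a b w : ℝ × ℝ} : w ∈ rect (toExt a) (toExt b) ↔ a ≤ w ∧ w ≤ b := by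
  simp [rect, toExt, Prod.le_def]

theorem norm_diag {t : ℝ} (ht : 0 ≤ t) : ‖diag t‖ = t := by
  simp [diag, Prod.norm_def, abs_of_nonneg ht]

/-- The point `r''` has the form `r' + 2a`, and is the lowest point of `I` on its diagonal. -/
theorem exists_cornerLower {I : Set (ℝ × ℝ)} (hI : IsInterval I) (hc : IsCompact I) :
    ∃ a : ℝ, 0 ≤ a ∧ cornerLower I = boxLower I + diag a ∧ ‖cornerLower I - boxLower I‖ = a ∧
      boxLower I + diag (2 * a) ∈ I ∧ ∀ t, boxLower I + diag t ∈ I → 2 * a ≤ t := by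
  have hp : IsDiagProj (lowerBoundary I) (boxLower I) (diagProj (lowerBoundary I) (boxLower I)) :=
    Classical.epsilon_spec (existsUnique_proj_lower hI hc).exists
  obtain ⟨⟨⟨t, ht⟩, hL⟩, -⟩ := hp
  rw [ht] at hL
  have hmem := hc.isClosed.closure_subset hL.1
  have ht0 : 0 ≤ t := by
    have := (box_bounds hc hmem).1.1
    simpa [diag] using this
  have hr : cornerLower I = boxLower I + diag (t / 2) := by
    rw [cornerLower, ht]
    ext <;> simp [diag] <;> ring
  refine ⟨t / 2, by positivity, hr, ?_, by rwa [mul_div_cancel₀ _ two_ne_zero], fun s hs => ?_⟩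
  · rw [hr, add_sub_cancel_left, norm_diag (by positivity)]
  · rw [mul_div_cancel₀ _ two_ne_zero]
    -- A lower point of `I` on this diagonal would be strictly smaller than r'' in both coordinates,
    -- which membership in the lower boundary forbids.
    by_contra! hlt
    exact hL.2 _ (by simpa [diag] using hlt) (by simpa [diag] using hlt) hs

/-- The point `s''` has the form `s' - 2b`, and is the highest point of `I` on its diagonal. -/
theorem exists_cornerUpper {I : Set (ℝ × ℝ)} (hI : IsInterval I) (hc : IsCompact I) :
    ∃ b : ℝ, 0 ≤ b ∧ cornerUpper I = boxUpper I - diag b ∧ ‖cornerUpper I - boxUpper I‖ = b ∧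
      boxUpper I - diag (2 * b) ∈ I ∧ ∀ t, boxUpper I - diag t ∈ I → 2 * b ≤ t := by
  have hp : IsDiagProj (upperBoundary I) (boxUpper I) (diagProj (upperBoundary I) (boxUpper I)) :=
    Classical.epsilon_spec (existsUnique_proj_upper hI hc).exists
  obtain ⟨⟨⟨t, ht⟩, hL⟩, -⟩ := hp
  obtain ⟨t, rfl⟩ : ∃ t', t = -t' := ⟨-t, (neg_neg t).symm⟩
  have hneg : boxUpper I + diag (-t) = boxUpper I - diag t := by
    ext <;> simp [diag] <;> ring
  rw [hneg] at ht
  rw [ht] at hL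
  have hmem := hc.isClosed.closure_subset hL.1
  have ht0 : 0 ≤ t := by
    have := (box_bounds hc hmem).2.1
    simpa [diag] using this
  have hr : cornerUpper I = boxUpper I - diag (t / 2) := by
    rw [cornerUpper, ht]
    ext <;> simp [diag] <;> ring
  refine ⟨t / 2, by positivity, hr, ?_, by rwa [mul_div_cancel₀ _ two_ne_zero], fun s hs => ?_⟩
  · rw [hr, sub_sub_cancel_left, norm_neg, norm_diag (by positivity)]
  · rw [mul_div_cancel₀ _ two_ne_zero]
    by_contra! hlt
    exact hL.2 _ (by simpa [diag] using hlt) (by simpa [diag] using hlt) hs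

theorem eps_nonneg (I : Set (ℝ × ℝ)) : 0 ≤ eps I := (norm_nonneg _).trans (le_max_left _ _)

/-- Points of `I` on the diagonals through `r'` and `s'` cannot both be close to `r''` and `s''`
from the outside. -/
theorem not_lt_eps {I : Set (ℝ × ℝ)} (hI : IsInterval I) (hc : IsCompact I) {t s : ℝ}
    (ht : boxLower I + diag t ∈ I) (hs : boxUpper I - diag s ∈ I) {δ : ℝ}
    (h1 : t ≤ max (2 * δ) (‖cornerLower I - boxLower I‖ + δ))
    (h2 : s ≤ max (2 * δ) (‖cornerUpper I - boxUpper I‖ + δ)) : ¬ δ < eps I := by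
  obtain ⟨a, -, -, ha, -, ha'⟩ := exists_cornerLower hI hc
  obtain ⟨b, -, -, hb, -, hb'⟩ := exists_cornerUpper hI hc
  have := ha' t ht
  have := hb' s hs
  rw [eps, ha, hb, not_lt]
  rw [ha] at h1
  rw [hb] at h2
  -- Either alternative, t ≤ 2δ or t ≤ a + δ, combines with 2a ≤ t to give a ≤ δ; likewise for b.
  -- The first arises for arbitrary rectangles, the second for [r, s].
  refine max_le ?_ ?_
  · rcases le_max_iff.1 h1 with h | h <;> linarith
  · rcases le_max_iff.1 h2 with h | h <;> linarith

/-! ### The upper bound -/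

theorem interleaved_cornerRectangle {I : Set (ℝ × ℝ)} (hI : IsInterval I) (hc : IsCompact I)
    {δ : ℝ≥0} (hδ : (δ : ℝ) = eps I) :
    Interleaved (intervalModule k I hI.ordConnected)
      (rectangleModule k (toExt (cornerLower I)) (toExt (cornerUpper I))) δ := by
  obtain ⟨a, ha0, har, ha, haI, -⟩ := exists_cornerLower hI hc
  obtain ⟨b, hb0, hbs, hb, hbI, -⟩ := exists_cornerUpper hI hc
  have hae : a ≤ eps I := ha ▸ le_max_left _ _
  have hbe : b ≤ eps I := hb ▸ le_max_right _ _
  have hbox := fun x hx => box_bounds hc (x := x) hx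
  simp only [Prod.le_def] at hbox
  refine interleaved_intervalModule _ _ ?_ ?_ ?_ ?_ <;>
    simp only [mem_rect_toExt, har, hbs, hδ, Prod.le_def, diag, Prod.fst_add,
      Prod.snd_add, Prod.fst_sub, Prod.snd_sub]
  -- The midpoint satisfies r ≤ r' + ε ≤ x + ε ≤ s' - ε ≤ s.
  · intro x hx hx'
    have h1 := hbox _ hx
    have h2 := hbox _ hx'
    simp only [Prod.fst_add, Prod.snd_add] at h2
    refine ⟨⟨?_, ?_⟩, ?_, ?_⟩ <;> linarith
  -- Here x + ε lies between r'' ≤ r + ε and s - ε ≤ s'', so convexity applies.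
  · rintro x ⟨⟨h1, h2⟩, h3, h4⟩ ⟨⟨h5, h6⟩, h7, h8⟩
    refine hI.ordConnected.out haI hbI ⟨⟨?_, ?_⟩, ?_, ?_⟩ <;>
      simp only [diag, Prod.fst_add, Prod.snd_add, Prod.fst_sub, Prod.snd_sub] <;> linarith
  · rintro x hx y ⟨h1, h2⟩ ⟨⟨h5, h6⟩, h7, h8⟩
    have h := hbox _ hx
    refine ⟨⟨⟨?_, ?_⟩, ?_, ?_⟩, hI.ordConnected.out hx hbI ⟨⟨?_, ?_⟩, ?_, ?_⟩⟩ <;>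
      try simp only [diag, Prod.fst_sub, Prod.snd_sub]
    all_goals linarith
  · rintro x ⟨⟨h1, h2⟩, h3, h4⟩ y ⟨h5, h6⟩ hy
    have h := hbox _ hy
    simp only [Prod.fst_add, Prod.snd_add] at h
    refine ⟨hI.ordConnected.out haI hy ⟨⟨?_, ?_⟩, ?_, ?_⟩, ⟨?_, ?_⟩, ?_, ?_⟩ <;>
      try simp only [diag, Prod.fst_add, Prod.snd_add]
    all_goals linarith

theorem interleavingDist_boxModule_le {I : Set (ℝ × ℝ)} (hI : IsInterval I) (hc : IsCompact I) :
    interleavingDist (intervalModule k I hI.ordConnected) (boxModule k I hI.ordConnected) ≤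
      ENNReal.ofReal (eps I) := by
  unfold boxModule
  split_ifs with h
  · exact h
  · have he := Real.coe_toNNReal _ (eps_nonneg I)
    exact interleavingDist_le (interleaved_cornerRectangle hI hc he) he

/-- Otherwise all shifts by 2e act as zero, and M is e-interleaved with 0. -/
theorem exists_mem_of_not_trivializable {I : Set (ℝ × ℝ)} {hI : I.OrdConnected} {e : ℝ}
    (he : 0 ≤ e) (h : ¬ Trivializable (intervalModule k I hI) e) :
    ∃ x ∈ I, x + diag e + diag e ∈ I := by
  by_contra! hne
  have he' := Real.coe_toNNReal e he
  refine h (interleavingDist_le (interleaved_zeroModule hI fun x hx => ?_) he')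
  rw [he']
  exact hne x hx

theorem add_diag_mem {I : Set (ℝ × ℝ)} (hI : I.OrdConnected) {x : ℝ × ℝ} {e δ : ℝ}
    (hx : x ∈ I) (hx' : x + diag e + diag e ∈ I) (hδ : 0 ≤ δ) (hδe : δ ≤ e) :
    x + diag δ + diag δ ∈ I := by
  refine hI.out hx hx' ⟨⟨?_, ?_⟩, ?_, ?_⟩ <;> simp [diag] <;> linarith

/-- The point x + ε separates the corners: r ≤ x + ε because r' ≤ x, and x + ε ≤ s because x + 2ε ≤
s'. -/
theorem cornerLower_le_cornerUpper {I : Set (ℝ × ℝ)} (hI : IsInterval I) (hc : IsCompact I)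
    {x : ℝ × ℝ} (hx : x ∈ I) (hx' : x + diag (eps I) + diag (eps I) ∈ I) :
    cornerLower I ≤ cornerUpper I := by
  obtain ⟨a, ha0, har, ha, -⟩ := exists_cornerLower hI hc
  obtain ⟨b, hb0, hbs, hb, -⟩ := exists_cornerUpper hI hc
  have hae : a ≤ eps I := ha ▸ le_max_left _ _
  have hbe : b ≤ eps I := hb ▸ le_max_right _ _
  have h1 := (box_bounds hc hx).1
  have h2 := (box_bounds hc hx').2
  rw [har, hbs]
  simp only [Prod.le_def, diag, Prod.fst_add, Prod.snd_add, Prod.fst_sub, Prod.snd_sub] at *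
  constructor <;> linarith

theorem boxModule_mem_rectangleModules {I : Set (ℝ × ℝ)} (hI : IsInterval I)
    (hc : IsCompact I) : boxModule k I hI.ordConnected ∈ rectangleModules k := by
  unfold boxModule
  split_ifs with h
  · exact Or.inl isZero_zeroModule
  · obtain ⟨x, hx, hx'⟩ := exists_mem_of_not_trivializable (eps_nonneg I) h
    exact Or.inr ⟨_, _, toExt_mono (cornerLower_le_cornerUpper hI hc hx hx'), ⟨Iso.refl _⟩⟩

/-! ### The lower bound for the approximating module -/

theorem eps_le_interleavingDist_boxModule {I : Set (ℝ × ℝ)} (hI : IsInterval I)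
    (hc : IsCompact I) (h : ENNReal.ofReal (eps I) ≤
      interleavingDist (intervalModule k I hI.ordConnected) (zeroModule k)) :
    ENNReal.ofReal (eps I) ≤
      interleavingDist (intervalModule k I hI.ordConnected) (boxModule k I hI.ordConnected) := by
  unfold boxModule
  split_ifs with ht
  · exact h
  obtain ⟨x, hx, hx'⟩ := exists_mem_of_not_trivializable (eps_nonneg I) ht
  obtain ⟨a, ha0, har, ha, -⟩ := exists_cornerLower hI hc
  obtain ⟨b, hb0, hbs, hb, -⟩ := exists_cornerUpper hI hc
  have hrs := cornerLower_le_cornerUpper hI hc hx hx'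
  refine le_interleavingDist fun δ hδ hint => ?_
  obtain ⟨hxJ, hlow, hupp⟩ := hint.mem_of_mem hx
    (add_diag_mem hI.ordConnected hx hx' δ.coe_nonneg hδ.le)
  rw [mem_rect_toExt] at hxJ
  -- Rigidity is applied to the two extreme points of [r, s]; the resulting points r + δ and s - δ
  -- of `I` lie on the diagonals of r' and s'.
  have h1 := hlow _ (mem_rect_toExt.2 ⟨le_rfl, hrs⟩) hxJ.1
  have h2 := hupp (cornerUpper I - diag δ)
    (by rw [sub_add_cancel]; exact mem_rect_toExt.2 ⟨hrs, le_rfl⟩) (le_sub_iff_add_le.2 hxJ.2)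
  refine not_lt_eps hI hc (t := a + δ) (s := b + δ) ?_ ?_ (ha ▸ le_max_right _ _)
    (hb ▸ le_max_right _ _) hδ
  · convert h1 using 1
    rw [har]
    ext <;> simp [diag] <;> ring
  · convert h2 using 1
    rw [hbs]
    ext <;> simp [diag] <;> ring

/-! ### Optimality -/

/-- The square can be slid within the rectangle `T` into the corner (r'₁, s'₂). The two points
differ by (2δ, 2δ), so they form a pair to which rigidity applies. -/
theorem topLeft_square_mem {I T : Set (ℝ × ℝ)} (hc : IsCompact I)
    (hT : IsTopLeftMaximalRectangle I T) {e δ : ℝ} (hsq : ContainsSquare T (2 * e))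
    (hδ : 0 ≤ δ) (hδe : δ ≤ e) :
    ((boxLower I).1, (boxUpper I).2 - 2 * δ) ∈ I ∧
      ((boxLower I).1 + 2 * δ, (boxUpper I).2) ∈ I := by
  obtain ⟨⟨⟨⟨u, v, -, rfl⟩, hTI⟩, -⟩, hp⟩ := hT
  obtain ⟨c, hsq⟩ := hsq
  have hc1 : c ∈ rect u v := hsq ⟨le_rfl, by constructor <;> simp [diag] <;> linarith⟩
  have hc2 : c + diag (2 * e) ∈ rect u v :=
    hsq ⟨by constructor <;> simp [diag] <;> linarith, le_rfl⟩
  have h1 := (box_bounds hc (hTI hc1)).1.1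
  have h2 := (box_bounds hc (hTI hc2)).2.2
  simp only [diag, Prod.snd_add] at h2
  refine ⟨hTI ⟨⟨hp.1.1, hc1.1.2.trans ?_⟩, hp.2.1, le_trans ?_ hp.2.2⟩,
    hTI ⟨⟨hp.1.1.trans ?_, hp.1.2⟩, le_trans ?_ hc2.2.1, hp.2.2⟩⟩ <;>
    simp only [toExt, diag, Prod.fst_add, EReal.coe_le_coe_iff] <;> linarith

theorem bottomRight_square_mem {I B : Set (ℝ × ℝ)} (hc : IsCompact I)
    (hB : IsBottomRightMaximalRectangle I B) {e δ : ℝ} (hsq : ContainsSquare B (2 * e))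
    (hδ : 0 ≤ δ) (hδe : δ ≤ e) :
    ((boxUpper I).1 - 2 * δ, (boxLower I).2) ∈ I ∧
      ((boxUpper I).1, (boxLower I).2 + 2 * δ) ∈ I := by
  obtain ⟨⟨⟨⟨u, v, -, rfl⟩, hBI⟩, -⟩, hp⟩ := hB
  obtain ⟨c, hsq⟩ := hsq
  have hc1 : c ∈ rect u v := hsq ⟨le_rfl, by constructor <;> simp [diag] <;> linarith⟩
  have hc2 : c + diag (2 * e) ∈ rect u v :=
    hsq ⟨by constructor <;> simp [diag] <;> linarith, le_rfl⟩
  have h1 := (box_bounds hc (hBI hc1)).1.2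
  have h2 := (box_bounds hc (hBI hc2)).2.1
  simp only [diag, Prod.fst_add] at h2
  refine ⟨hBI ⟨⟨hc1.1.1.trans ?_, hp.1.2⟩, le_trans ?_ hp.2.1, hp.2.2⟩,
    hBI ⟨⟨hp.1.1, hp.1.2.trans ?_⟩, hp.2.1, le_trans ?_ hc2.2.2⟩⟩ <;>
    simp only [toExt, diag, Prod.snd_add, EReal.coe_le_coe_iff] <;> linarith

/-- If the top-left and bottom-right maximal rectangles of `I` contain squares of side `2 ε_M`,
then no rectangle module is closer than `ε_M` to the interval module of `I`. -/
theorem eps_le_interleavingDist_of_squares {I T B : Set (ℝ × ℝ)} (hI : IsInterval I)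
    (hc : IsCompact I) (hT : IsTopLeftMaximalRectangle I T)
    (hB : IsBottomRightMaximalRectangle I B) (hTs : ContainsSquare T (2 * eps I))
    (hBs : ContainsSquare B (2 * eps I)) {N : PersMod k} (hN : N ∈ rectangleModules k) :
    ENNReal.ofReal (eps I) ≤ interleavingDist (intervalModule k I hI.ordConnected) N := by
  refine le_interleavingDist fun δ hδ hint => ?_
  obtain ⟨t1, t2⟩ := topLeft_square_mem hc hT hTs δ.coe_nonneg hδ.le
  obtain ⟨b1, b2⟩ := bottomRight_square_mem hc hB hBs δ.coe_nonneg hδ.le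
  have t2' : ((boxLower I).1, (boxUpper I).2 - 2 * (δ : ℝ)) + diag δ + diag δ ∈ I := by
    convert t2 using 1
    ext <;> simp [diag] <;> ring
  have b2' : ((boxUpper I).1 - 2 * (δ : ℝ), (boxLower I).2) + diag δ + diag δ ∈ I := by
    convert b2 using 1
    ext <;> simp [diag] <;> ring
  rcases hN with hN | ⟨u, v, -, ⟨e⟩⟩
  · exact not_interleaved_of_isZero hN t1 t2' hint
  obtain ⟨ht, hlow, hupp⟩ := (hint.of_iso e).mem_of_mem t1 t2'
  obtain ⟨hb, -⟩ := (hint.of_iso e).mem_of_mem b1 b2'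
  have ht1 := box_bounds hc t1
  have hb1 := box_bounds hc b1
  simp only [Prod.le_def] at ht1 hb1
  -- A rectangle is a product, so coordinates of its points (r'₁ + δ, s'₂ - δ) and (s'₁ - δ, r'₂ +
  -- δ) may be mixed.
  have hl : boxLower I + diag δ ∈ rect u v := by
    refine ⟨⟨ht.1.1, hb.1.2⟩, le_trans ?_ ht.2.1, le_trans ?_ hb.2.2⟩ <;> simp [toExt, diag]
  have hu : boxUpper I - diag δ ∈ rect u v := by
    refine ⟨⟨hb.1.1.trans ?_, ht.1.2.trans ?_⟩, le_trans ?_ hb.2.1, le_trans ?_ ht.2.2⟩ <;>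
      simp only [toExt, diag, Prod.fst_add, Prod.snd_add, Prod.fst_sub, Prod.snd_sub,
        EReal.coe_le_coe_iff] <;> linarith
  have hlx : boxLower I + diag δ ≤ ((boxLower I).1, (boxUpper I).2 - 2 * (δ : ℝ)) + diag δ :=
    add_diag_le_add_diag (box_bounds hc t1).1 _
  -- The first coordinate needs r'₁ + 2δ ≤ s'₁, which holds because (r'₁ + 2δ, s'₂) lies in `I`.
  have hux : ((boxLower I).1, (boxUpper I).2 - 2 * (δ : ℝ)) ≤ boxUpper I - diag δ - diag δ := by
    have := (box_bounds hc t2).2.1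
    constructor <;> simp [diag] <;> linarith
  have h1 := hlow _ hl hlx
  have h2 := hupp _ ((sub_add_cancel (boxUpper I - diag δ) (diag δ)).symm ▸ hu) hux
  refine not_lt_eps hI hc (t := 2 * δ) (s := 2 * δ) ?_ ?_ (le_max_left _ _) (le_max_left _ _) hδ
  · convert h1 using 1
    ext <;> simp [diag] <;> ring
  · convert h2 using 1
    ext <;> simp [diag] <;> ring

end

end RectApprox

theorem theorem3p2 {k : Type*} [Field k] (I : Set (ℝ × ℝ)) (hI : RectApprox.IsInterval I)
    (hclosed : IsClosed I) (hbdd : Bornology.IsBounded I) :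
    RectApprox.interleavingDist (RectApprox.intervalModule k I hI.ordConnected)
        (RectApprox.boxModule k I hI.ordConnected) ≤ ENNReal.ofReal (RectApprox.eps I) ∧
    (ENNReal.ofReal (RectApprox.eps I) ≤
        RectApprox.interleavingDist (RectApprox.intervalModule k I hI.ordConnected)
          (RectApprox.zeroModule k) →
      RectApprox.interleavingDist (RectApprox.intervalModule k I hI.ordConnected)
        (RectApprox.boxModule k I hI.ordConnected) = ENNReal.ofReal (RectApprox.eps I)) ∧
    (∀ T B : Set (ℝ × ℝ), RectApprox.IsTopLeftMaximalRectangle I T →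
      RectApprox.IsBottomRightMaximalRectangle I B →
      RectApprox.ContainsSquare T (2 * RectApprox.eps I) →
      RectApprox.ContainsSquare B (2 * RectApprox.eps I) →
      RectApprox.ApproximatesOptimally RectApprox.interleavingDist
        (RectApprox.intervalModule k I hI.ordConnected) (RectApprox.rectangleModules k)
        (RectApprox.boxModule k I hI.ordConnected)) := by
  have hc : IsCompact I := Metric.isCompact_of_isClosed_isBounded hclosed hbdd
  have hle := RectApprox.interleavingDist_boxModule_le (k := k) hI hc
  have hmem := RectApprox.boxModule_mem_rectangleModules (k := k) hI hc
  -- For optimality, every rectangle module is at distance at least ε, while the approximation is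
  -- itself one at distance at most ε.
  refine ⟨hle, fun h => hle.antisymm (RectApprox.eps_le_interleavingDist_boxModule hI hc h),
    fun T B hT hB hTs hBs => ⟨hmem, le_antisymm (le_iInf₂ fun N hN => hle.trans ?_)
      (iInf₂_le _ hmem)⟩⟩
  exact RectApprox.eps_le_interleavingDist_of_squares hI hc hT hB hTs hBs hN
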